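/- Let $(V,\Delta,V^*,\Delta^\vee)$ be a Kac–Moody root system: $V$ is a finite-dimensional real vector space, $\Delta\subset V$ and $\Delta^\vee\subset V^*$ are finite linearly independent sets with a bijection $a\mapsto a^\vee$ from $\Delta$ to $\Delta^\vee$, such that $\langle a,a^\vee\rangle=2$ for $a\in\Delta$, $\langle a,b^\vee\rangle$ is a non-positive integer for $a\ne b$ in $\Delta$, and $\langle a,b^\vee\rangle=0$ implies $\langle b,a^\vee\rangle=0$. Let $W\subset\mathrm{Aut}(V)$ be the Weyl group, generated by the reflections $s_a(v)=v-\langle v,a^\vee\rangle a$ ($a\in\Delta$), with length function $\ell$, acting on $V^*$ by $\langle v,wl\rangle=\langle w^{-1}v,l\rangle$. Let $\Phi_{re}=W\Delta$ be the set of real roots, with coroots $(wa)^\vee=wa^\vee$ ($w\in W$, $a\in\Delta$), let $\Phi_{re,+}$ be the set of those real roots that are combinations of simple roots with non-negative integer coefficients, and put $\Phi(w)=\{b\in\Phi_{re,+}: -w^{-1}b\in\Phi_{re,+}\}$. Let $C=\{y\in V:\langle y,a^\vee\rangle>0\ \text{for all } a\in\Delta\}$ and $V+iC=\{x+iy: x\in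 V,\ y\in C\}\subset V\otimes\mathbb C$. Let $r$ be the radius of convergence of the Poincaré series $W(t)=\sum_{w\in W}t^{\ell(w)}$, and let $D_r=\{t\in\mathbb C:|t|<r\}$ if $W$ is infinite (in which case $r\le 1$), while $D_r$ denotes the open unit disc if $W$ is finite. For $(t,h)\in D_r\times(V+iC)$ each set $\Phi(w)$ is finite, and $1-te^{2\pi i\langle h,b^\vee\rangle}\neq0$ and $1-e^{2\pi i\langle h,b^\vee\rangle}\ne0$ for all $b\in\Phi_{re,+}$. The expression $$\mathcal C(t,h)=\left(\sum_{w\in W}\prod_{b\in\Phi(w)}\frac{t-e^{2\pi i\langle h,b^\vee\rangle}}{1-te^{2\pi i\langle h,b^\vee\rangle}}\right)\left(\prod_{b\in\Phi_{re,+}}\frac{1-te^{2\pi i\langle h,b^\vee\rangle}}{1-e^{2\pi i\langle h,b^\vee\rangle}}\right)$$ converges absolutely, uniformly on compact subsets of $D_r\times(V+iC)$; that is, on every compact subset the sum over $W$ and the product over $\Phi_{re,+}$ converge uniformly, the sum of the absolute values of the terms of the former converges uniformly, so does the sum of the absolute values of (factor $-\,1$) of the latter, and the products of the partial sums with the partial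 products converge uniformly to $\mathcal C$. The set $D_r\times(V+iC)$ is open in $\mathbb C\times(V\otimes\mathbb C)$, and $\mathcal C$ is a holomorphic function on it. -/

import Mathlib

open scoped TensorProduct

noncomputable section

/-! ### The complexification of a finite-dimensional real vector space -/

/-- The complexification `V ⊗ ℂ` of a real vector space `V`. -/
def Complexification (V : Type*) [AddCommGroup V] [Module ℝ V] : Type _ := ℂ ⊗[ℝ] V

namespace Complexification

variable {V : Type*} [AddCommGroup V] [Module ℝ V]

instance instAddCommGroup : AddCommGroup (Complexification V) :=
  inferInstanceAs (AddCommGroup (ℂ ⊗[ℝ] V))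

instance instModule : Module ℂ (Complexification V) :=
  inferInstanceAs (Module ℂ (ℂ ⊗[ℝ] V))

/-- The vector `x + i y` of `V ⊗ ℂ = V + i V`. -/
def mk (x y : V) : Complexification V :=
  ((1 : ℂ) ⊗ₜ[ℝ] x + Complex.I ⊗ₜ[ℝ] y : ℂ ⊗[ℝ] V)

/-- The complex-linear extension of the natural pairing between `V` and its dual. -/
def pairing (h : Complexification V) (l : Module.Dual ℝ V) : ℂ :=
  Module.Dual.baseChange ℂ l (h : ℂ ⊗[ℝ] V)

theorem pairing_mk (x y : V) (l : Module.Dual ℝ V) :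
    pairing (mk x y) l = (l x : ℂ) + (l y : ℂ) * Complex.I := by
  simp only [pairing, mk, map_add]
  simp [mul_comm]

variable [Module.Finite ℝ V]

instance instFinite : Module.Finite ℂ (Complexification V) :=
  inferInstanceAs (Module.Finite ℂ (ℂ ⊗[ℝ] V))

/-- Coordinates with respect to some basis of `V ⊗ ℂ`. -/
def coordEquiv (V : Type*) [AddCommGroup V] [Module ℝ V] [Module.Finite ℝ V] :
    Complexification V ≃ₗ[ℂ] (Fin (Module.finrank ℂ (Complexification V)) → ℂ) :=
  (Module.finBasis ℂ (Complexification V)).equivFun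

/-- `V ⊗ ℂ` is normed through coordinates. The choice of the norm is immaterial: on a
finite-dimensional complex vector space all norms are equivalent, and only the topology and the
notion of complex differentiability, which do not depend on it, are used. -/
instance instNormedAddCommGroup : NormedAddCommGroup (Complexification V) :=
  NormedAddCommGroup.induced (Complexification V) _ (coordEquiv V) (coordEquiv V).injective

instance instNormedSpace : NormedSpace ℂ (Complexification V) :=
  NormedSpace.induced ℂ (Complexification V) _ (coordEquiv V)

end Complexification

/-! ### Kac-Moody root systems -/

/-- A Kac-Moody root system in the real vector space `V`. The simple roots and the simple coroots
are indexed by `ι`, which encodes the bijection `a ↦ a^∨` between them. -/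
structure KacMoodyRootSystem (ι V : Type*) [AddCommGroup V] [Module ℝ V] where
  /-- The simple roots. -/
  simpleRoot : ι → V
  /-- The simple coroots. -/
  simpleCoroot : ι → Module.Dual ℝ V
  linearIndependent_simpleRoot : LinearIndependent ℝ simpleRoot
  linearIndependent_simpleCoroot : LinearIndependent ℝ simpleCoroot
  pairing_self : ∀ i, simpleCoroot i (simpleRoot i) = 2
  pairing_nonpos_integer : ∀ i j, i ≠ j → ∃ n : ℤ, n ≤ 0 ∧ simpleCoroot j (simpleRoot i) = n
  pairing_eq_zero : ∀ i j, simpleCoroot j (simpleRoot i) = 0 → simpleCoroot i (simpleRoot j) = 0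

namespace KacMoodyRootSystem

variable {ι V : Type*} [AddCommGroup V] [Module ℝ V] (R : KacMoodyRootSystem ι V)

/-- The fundamental reflection `v ↦ v - ⟨v, a_i^∨⟩ a_i`. -/
def simpleReflection (i : ι) : V ≃ₗ[ℝ] V := Module.reflection (R.pairing_self i)

/-- The Weyl group, generated by the fundamental reflections. -/
def weylGroup : Subgroup (V ≃ₗ[ℝ] V) := Subgroup.closure (Set.range R.simpleReflection)

/-- The length of `w`: the least length of a word in the fundamental reflections with product `w`.
(The fundamental reflections are involutions, so every `w` in the Weyl group has such a word.) -/
def length (w : R.weylGroup) : ℕ :=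
  sInf {n | ∃ l : List ι, l.length = n ∧ (l.map R.simpleReflection).prod = (w : V ≃ₗ[ℝ] V)}

/-- The radius of convergence of the Poincaré series `W(t) = ∑_w t ^ ℓ(w)`, whose coefficient at
`t ^ n` is the (finite) number of elements of length `n`. -/
def poincareRadius : ENNReal :=
  (FormalMultilinearSeries.ofScalars ℂ
    (fun n : ℕ => (Nat.card {w : R.weylGroup // R.length w = n} : ℂ))).radius

/-- The real roots: the vectors that are conjugate to a simple root under the Weyl group. -/
def realRoots : Set V := {b | ∃ (w : R.weylGroup) (i : ι), (w : V ≃ₗ[ℝ] V) (R.simpleRoot i) = b}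

/-- The positive real roots: the real roots that are linear combinations of simple roots with
non-negative integer coefficients. -/
def posRealRoots : Set V :=
  {b | b ∈ R.realRoots ∧ b ∈ AddSubmonoid.closure (Set.range R.simpleRoot)}

/-- The real coroot `b^∨` of a real root `b`: if `b = w a_i` then `b^∨ = w a_i^∨`, where the Weyl
group acts on the dual of `V` by `⟨v, w l⟩ = ⟨w⁻¹ v, l⟩`. It is a standard fact that `w a_i^∨`
depends on `b` only, so that it does not matter which `w` and `i` are chosen. -/
def coroot (b : R.realRoots) : Module.Dual ℝ V :=
  ((b.2.choose : V ≃ₗ[ℝ] V).symm.dualMap) (R.simpleCoroot b.2.choose_spec.choose)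

theorem coroot_spec (b : R.realRoots) :
    ∃ (w : R.weylGroup) (i : ι), (w : V ≃ₗ[ℝ] V) (R.simpleRoot i) = (b : V) ∧
      R.coroot b = (w : V ≃ₗ[ℝ] V).symm.dualMap (R.simpleCoroot i) :=
  ⟨b.2.choose, b.2.choose_spec.choose, b.2.choose_spec.choose_spec, rfl⟩

/-- The set `Φ(w)` of the positive real roots `b` such that `w⁻¹ b` is negative. -/
def inversionSet (w : R.weylGroup) : Set R.posRealRoots :=
  {b | -((w : V ≃ₗ[ℝ] V).symm (b : V)) ∈ R.posRealRoots}

/-- The open dominant chamber `C`. -/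
def dominantChamber : Set V := {y | ∀ i, 0 < R.simpleCoroot i y}

/-- The tube domain `V + i C` in `V ⊗ ℂ`. -/
def tube : Set (Complexification V) :=
  {h | ∃ x : V, ∃ y ∈ R.dominantChamber, h = Complexification.mk x y}

/-- The open disc `|t| < r`, where `r` is the radius of convergence of the Poincaré series. If the
Weyl group is finite (so that `r = ∞`), the disc is cut down to the unit disc. -/
def disc : Set ℂ := {t | ‖t‖ₑ < R.poincareRadius ∧ (Finite R.weylGroup → ‖t‖ < 1)}

/-- The exponential `e^{2 π i ⟨h, b^∨⟩}`. -/
def expCoroot (h : Complexification V) (b : R.posRealRoots) : ℂ :=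
  Complex.exp (2 * Real.pi * Complex.I * h.pairing (R.coroot ⟨b, b.2.1⟩))

/-- The term of the sum over the Weyl group that belongs to `w`. -/
def sumTerm (w : R.weylGroup) (p : ℂ × Complexification V) : ℂ :=
  ∏ᶠ b ∈ R.inversionSet w,
    (p.1 - R.expCoroot p.2 b) / (1 - p.1 * R.expCoroot p.2 b)

/-- The factor of the product over the positive real roots that belongs to `b`. -/
def prodFactor (b : R.posRealRoots) (p : ℂ × Complexification V) : ℂ :=
  (1 - p.1 * R.expCoroot p.2 b) / (1 - R.expCoroot p.2 b)

/-- The function `𝒞(t, h)`. -/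
def correction (p : ℂ × Complexification V) : ℂ :=
  (∑' w : R.weylGroup, R.sumTerm w p) * ∏' b : R.posRealRoots, R.prodFactor b p

end KacMoodyRootSystem

end

/-!
The proof has an algebraic half, the geometry of real roots, and an analytic half, a dominated
convergence argument.

*Signs.* The basic fact is `mem_cones_of_wordLength_le`: if `ℓ(g) ≤ ℓ(g s_i)`, then `g a_i` is a
non-negative integral combination of simple roots and its coroot `g a_i^∨` is one of simple coroots.
As for Coxeter groups, an induction on `ℓ(g)` reduces this to the subgroup generated by two
fundamental reflections. There the Cartan matrix is symmetrizable, so that the two coefficients of a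
real root satisfy the equation of an invariant quadratic form; being integers, they cannot have
opposite signs (`rankTwo_form_gt`), whatever the order of the product of the two reflections is.
Hence every real root is positive or negative, and its coroot has the same sign.

*Consequences.* A fundamental reflection `s_i` permutes the positive real roots other than `a_i`, so
that `Φ(w)` is finite and has at least `ℓ(w)` elements (`length_le_card_inversionSet`). Moreover
`b ↦ b^∨` embeds the positive real roots into the non-negative integral combinations of the simple
coroots (`posCoroot_injective`).

*Convergence.* On a compact subset of the domain, `|e^{2πi⟨h, b^∨⟩}| ≤ q ^ ht(b^∨)` for some
`q < 1`, and these bounds are summable over `b` by the embedding just mentioned. This settles the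
product. If `|t| ≤ ρ` on the compact set with `ρ ≤ 1` less than the radius of convergence, then each
factor of the term of `w` is at most `ρ (1 + C q ^ ht(b^∨))`; as there are at least `ℓ(w)` factors,
the term is at most a constant times `ρ ^ ℓ(w)`, and `∑_w ρ ^ ℓ(w)` is the Poincaré series at `ρ`
(`exists_summable_bounds`). Holomorphy of the limit is Weierstrass' theorem, which is deduced here
in several variables from Cauchy's estimate on complex lines
(`TendstoUniformlyOn.differentiableAt_of_ball`).
-/

open scoped TensorProduct

namespace KacMoodyRootSystem

variable {ι V : Type*} [AddCommGroup V] [Module ℝ V] (R : KacMoodyRootSystem ι V)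

/-! ### Words in the fundamental reflections -/

/-- The action of `g` on the dual space, `⟨v, g l⟩ = ⟨g⁻¹ v, l⟩`. -/
def dualAct (g : V ≃ₗ[ℝ] V) : Module.Dual ℝ V →ₗ[ℝ] Module.Dual ℝ V := g.symm.dualMap

theorem dualAct_apply (g : V ≃ₗ[ℝ] V) (f : Module.Dual ℝ V) (v : V) :
    dualAct g f v = f (g.symm v) := rfl

theorem dualAct_apply_self (g : V ≃ₗ[ℝ] V) (f : Module.Dual ℝ V) (v : V) :
    dualAct g f (g v) = f v := by
  rw [dualAct_apply, g.symm_apply_apply]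

theorem dualAct_mul (g h : V ≃ₗ[ℝ] V) (f : Module.Dual ℝ V) :
    dualAct (g * h) f = dualAct g (dualAct h f) := rfl

theorem dualAct_one (f : Module.Dual ℝ V) : dualAct (1 : V ≃ₗ[ℝ] V) f = f := rfl

theorem simpleReflection_apply (i : ι) (v : V) :
    R.simpleReflection i v = v - R.simpleCoroot i v • R.simpleRoot i :=
  Module.reflection_apply v (R.pairing_self i)

theorem simpleReflection_mul_self (i : ι) : R.simpleReflection i * R.simpleReflection i = 1 := by
  ext v
  exact Module.involutive_reflection (R.pairing_self i) v

theorem simpleReflection_inv (i : ι) : (R.simpleReflection i)⁻¹ = R.simpleReflection i :=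
  inv_eq_of_mul_eq_one_left (R.simpleReflection_mul_self i)

theorem simpleReflection_simpleReflection (i : ι) (v : V) :
    R.simpleReflection i (R.simpleReflection i v) = v :=
  Module.involutive_reflection (R.pairing_self i) v

theorem simpleReflection_symm (i : ι) :
    (R.simpleReflection i).symm = R.simpleReflection i := R.simpleReflection_inv i

theorem simpleReflection_simpleRoot (i : ι) :
    R.simpleReflection i (R.simpleRoot i) = -R.simpleRoot i := by
  rw [simpleReflection_apply, R.pairing_self, two_smul]; abel

theorem dualAct_simpleReflection (i : ι) (f : Module.Dual ℝ V) :
    dualAct (R.simpleReflection i) f = f - f (R.simpleRoot i) • R.simpleCoroot i := by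
  ext v
  rw [dualAct_apply, simpleReflection_symm, simpleReflection_apply]
  simp [mul_comm]

theorem dualAct_simpleReflection_simpleCoroot (i : ι) :
    dualAct (R.simpleReflection i) (R.simpleCoroot i) = -R.simpleCoroot i := by
  rw [dualAct_simpleReflection, R.pairing_self, two_smul]; abel

/-- A transformation that moves the pair (simple root, simple coroot) of `i` to that of `k`
intertwines the two fundamental reflections. -/
theorem mul_simpleReflection_of_eq {g : V ≃ₗ[ℝ] V} {i k : ι}
    (h₁ : g (R.simpleRoot i) = R.simpleRoot k)
    (h₂ : dualAct g (R.simpleCoroot i) = R.simpleCoroot k) :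
    g * R.simpleReflection i = R.simpleReflection k * g := by
  ext v
  simp only [LinearEquiv.mul_apply, simpleReflection_apply, map_sub, map_smul, h₁, ← h₂,
    dualAct_apply_self]

/-- The product of the fundamental reflections along a word. -/
def wordProd (L : List ι) : V ≃ₗ[ℝ] V := (L.map R.simpleReflection).prod

@[simp] theorem wordProd_nil : R.wordProd [] = 1 := rfl

@[simp] theorem wordProd_cons (i : ι) (L : List ι) :
    R.wordProd (i :: L) = R.simpleReflection i * R.wordProd L := by
  simp [wordProd]

@[simp] theorem wordProd_append (L M : List ι) :
    R.wordProd (L ++ M) = R.wordProd L * R.wordProd M := by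
  simp [wordProd]

theorem simpleReflection_mem (i : ι) : R.simpleReflection i ∈ R.weylGroup :=
  Subgroup.subset_closure ⟨i, rfl⟩

theorem wordProd_mem (L : List ι) : R.wordProd L ∈ R.weylGroup := by
  induction L with
  | nil => exact one_mem _
  | cons i L ih => rw [wordProd_cons]; exact mul_mem (R.simpleReflection_mem i) ih

theorem exists_wordProd_eq {g : V ≃ₗ[ℝ] V} (hg : g ∈ R.weylGroup) : ∃ L, R.wordProd L = g := by
  induction hg using Subgroup.closure_induction with
  | mem x hx => obtain ⟨i, rfl⟩ := hx; exact ⟨[i], by simp⟩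
  | one => exact ⟨[], rfl⟩
  | mul x y _ _ hx hy =>
    obtain ⟨L, rfl⟩ := hx
    obtain ⟨M, rfl⟩ := hy
    exact ⟨L ++ M, by simp⟩
  | inv x _ hx =>
    obtain ⟨L, rfl⟩ := hx
    refine ⟨L.reverse, ?_⟩
    clear * -
    induction L with
    | nil => simp
    | cons i L ih => simp [ih, simpleReflection_inv]

/-- The length function on all of `V ≃ₗ[ℝ] V` (with the junk value `0` outside the Weyl group). -/
noncomputable def wordLength (g : V ≃ₗ[ℝ] V) : ℕ :=
  sInf {n | ∃ L : List ι, L.length = n ∧ R.wordProd L = g}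

theorem length_eq_wordLength (w : R.weylGroup) :
    R.length w = R.wordLength (w : V ≃ₗ[ℝ] V) := rfl

theorem wordLength_wordProd_le (L : List ι) : R.wordLength (R.wordProd L) ≤ L.length :=
  Nat.sInf_le ⟨L, rfl, rfl⟩

theorem exists_reduced_word {g : V ≃ₗ[ℝ] V} (hg : g ∈ R.weylGroup) :
    ∃ L : List ι, L.length = R.wordLength g ∧ R.wordProd L = g := by
  obtain ⟨L, hL⟩ := R.exists_wordProd_eq hg
  exact Nat.sInf_mem (s := {n | ∃ L : List ι, L.length = n ∧ R.wordProd L = g}) ⟨_, L, rfl, hL⟩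

theorem wordLength_mul_wordProd_le {g : V ≃ₗ[ℝ] V} (hg : g ∈ R.weylGroup) (L : List ι) :
    R.wordLength (g * R.wordProd L) ≤ R.wordLength g + L.length := by
  obtain ⟨M, hM, rfl⟩ := R.exists_reduced_word hg
  rw [← wordProd_append, ← hM, ← List.length_append]
  exact R.wordLength_wordProd_le _

/-! ### Roots and coroots of rank two -/

/-- The off-diagonal entries of the Cartan matrix of two simple roots, together with a
symmetrization: a rank-two generalized Cartan matrix is always symmetrizable. -/
theorem exists_rankTwo_symmetrization {i j : ι} (hij : i ≠ j) :
    ∃ a b c d : ℤ, 0 ≤ b ∧ 0 < c ∧ 0 < d ∧ c * b = d * a ∧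
      R.simpleCoroot j (R.simpleRoot i) = -a ∧ R.simpleCoroot i (R.simpleRoot j) = -b := by
  obtain ⟨m, hm, hm'⟩ := R.pairing_nonpos_integer i j hij
  obtain ⟨n, hn, hn'⟩ := R.pairing_nonpos_integer j i hij.symm
  by_cases h : m = 0
  · have : n = 0 := by
      have := R.pairing_eq_zero i j (by simp [hm', h])
      rw [hn'] at this
      exact_mod_cast this
    exact ⟨0, 0, 1, 1, by simp [hm', hn', h, this]⟩
  · have h' : n ≠ 0 := by
      rintro rfl
      have := R.pairing_eq_zero j i (by simp [hn'])
      rw [hm'] at this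
      exact h (by exact_mod_cast this)
    refine ⟨-m, -n, -m, -n, by lia, by lia, by lia, by ring, ?_, ?_⟩ <;> simp [hm', hn']

/-- Two integers of opposite signs do not represent `c` (or anything smaller) by the invariant
form: a root of rank two has coefficients of one sign. -/
theorem rankTwo_form_gt {b c d x y : ℤ} (hb : 0 ≤ b) (hc : 0 < c) (hd : 0 < d)
    (hxy : x ≤ -1 ∧ 1 ≤ y ∨ 1 ≤ x ∧ y ≤ -1) :
    c < c * x ^ 2 - c * b * (x * y) + d * y ^ 2 := by
  have h1 : x * y ≤ 0 := by rcases hxy with h | h <;> nlinarith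
  have h2 : 1 ≤ x ^ 2 := by rcases hxy with h | h <;> nlinarith
  have h3 : 1 ≤ y ^ 2 := by rcases hxy with h | h <;> nlinarith
  nlinarith [mul_nonneg (mul_nonneg hc.le hb) (neg_nonneg.2 h1), mul_le_mul_of_nonneg_left h2 hc.le,
    mul_le_mul_of_nonneg_left h3 hd.le]

/-- The induction behind `rankTwo_word`. The coefficients `(x, y)` of a root and `(x, y')` of its
coroot are tracked along the word; `c y' = d y` and the equation of the invariant form hold
throughout. When a letter `k` turns a positive root into a negative one, that root is `a_k`, and
deleting this letter gives a shorter word. -/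
theorem rankTwo_word_aux {i j : ι} {a b c d : ℤ} (hb : 0 ≤ b) (hc : 0 < c) (hd : 0 < d)
    (hcd : c * b = d * a) (hji : R.simpleCoroot j (R.simpleRoot i) = -a)
    (hij : R.simpleCoroot i (R.simpleRoot j) = -b) (L : List ι) (hL : ∀ k ∈ L, k = i ∨ k = j) :
    (∃ L' : List ι, L'.length < L.length ∧
      R.wordProd L' = R.wordProd L * R.simpleReflection i) ∨
    ∃ x y y' : ℤ, 0 ≤ x ∧ 0 ≤ y ∧ 0 ≤ y' ∧ c * y' = d * y ∧
      c * x ^ 2 - c * b * (x * y) + d * y ^ 2 = c ∧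
      R.wordProd L (R.simpleRoot i) = (x : ℝ) • R.simpleRoot i + (y : ℝ) • R.simpleRoot j ∧
      dualAct (R.wordProd L) (R.simpleCoroot i) =
        (x : ℝ) • R.simpleCoroot i + (y' : ℝ) • R.simpleCoroot j := by
  induction L with
  | nil => exact Or.inr ⟨1, 0, 0, by simp [dualAct_one]⟩
  | cons k M ih =>
    rcases ih fun k hk => hL k (List.mem_cons_of_mem _ hk) with ⟨L', hL', hL''⟩ | h
    · exact Or.inl ⟨k :: L', by simpa using hL', by simp [hL'', mul_assoc]⟩
    obtain ⟨x, y, y', hx, hy, hy', hyy', hQ, h₁, h₂⟩ := h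
    have delete (h₁ : R.wordProd M (R.simpleRoot i) = R.simpleRoot k)
        (h₂ : dualAct (R.wordProd M) (R.simpleCoroot i) = R.simpleCoroot k) :
        ∃ L' : List ι, L'.length < (k :: M).length ∧
          R.wordProd L' = R.wordProd (k :: M) * R.simpleReflection i := by
      refine ⟨M, by simp, ?_⟩
      rw [wordProd_cons, mul_assoc, R.mul_simpleReflection_of_eq h₁ h₂, ← mul_assoc,
        simpleReflection_mul_self, one_mul]
    have hyy'' : a * y' = b * y := by
      refine mul_left_cancel₀ hc.ne' ?_
      linear_combination a * hyy' - y * hcd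
    rcases hL k (by simp) with rfl | rfl
    · by_cases hX : 0 ≤ -x + b * y
      · refine Or.inr ⟨-x + b * y, y, y', hX, hy, hy', hyy', ?_, ?_, ?_⟩
        · linear_combination hQ
        · rw [wordProd_cons, LinearEquiv.mul_apply, h₁, simpleReflection_apply]
          simp only [map_add, map_smul, R.pairing_self, hij, smul_eq_mul]
          push_cast
          module
        · rw [wordProd_cons, dualAct_mul, h₂, dualAct_simpleReflection]
          simp only [LinearMap.add_apply, LinearMap.smul_apply, R.pairing_self, hji, smul_eq_mul]
          rw [← hyy'']
          push_cast
          module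
      · have hy0 : y = 0 := by
          by_contra h0
          have := rankTwo_form_gt hb hc hd (x := -x + b * y) (y := y) (Or.inl (by lia))
          have h3 : c * (-x + b * y) ^ 2 - c * b * ((-x + b * y) * y) + d * y ^ 2 = c := by
            linear_combination hQ
          lia
        subst hy0
        have hy0' : y' = 0 := by
          have : c * y' = 0 := by rw [hyy']; ring
          exact (mul_eq_zero.1 this).resolve_left hc.ne'
        have hx1 : x = 1 := by
          have : x ^ 2 = 1 := mul_left_cancel₀ hc.ne' (by linear_combination hQ)
          nlinarith
        subst hx1 hy0'
        exact Or.inl (delete (by simpa using h₁) (by simpa using h₂))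
    · by_cases hY : 0 ≤ -y + a * x
      · have hcy : c * (-y' + b * x) = d * (-y + a * x) := by linear_combination x * hcd - hyy'
        refine Or.inr ⟨x, -y + a * x, -y' + b * x, hx, hY, ?_, hcy, ?_, ?_, ?_⟩
        · exact nonneg_of_mul_nonneg_right (hcy ▸ mul_nonneg hd.le hY) hc
        · linear_combination hQ + (2 * x * y - a * x ^ 2) * hcd
        · rw [wordProd_cons, LinearEquiv.mul_apply, h₁, simpleReflection_apply]
          simp only [map_add, map_smul, R.pairing_self, hji, smul_eq_mul]
          push_cast
          module
        · rw [wordProd_cons, dualAct_mul, h₂, dualAct_simpleReflection]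
          simp only [LinearMap.add_apply, LinearMap.smul_apply, R.pairing_self, hij, smul_eq_mul]
          push_cast
          module
      · have hx0 : x = 0 := by
          by_contra h0
          have := rankTwo_form_gt hb hc hd (x := x) (y := -y + a * x) (Or.inr (by lia))
          have h3 : c * x ^ 2 - c * b * (x * (-y + a * x)) + d * (-y + a * x) ^ 2 = c := by
            linear_combination hQ + (2 * x * y - a * x ^ 2) * hcd
          lia
        subst hx0
        have hQ' : d * y ^ 2 = c := by linear_combination hQ
        have hy0 : y ≠ 0 := by rintro rfl; simp at hQ'; lia
        have hyy1 : y * y' = 1 := by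
          refine mul_left_cancel₀ (mul_ne_zero hd.ne' hy0) ?_
          linear_combination hyy' + y' * hQ'
        have hy1 : y = 1 := Int.eq_one_of_mul_eq_one_right hy hyy1
        subst hy1
        have hy1' : y' = 1 := by lia
        subst hy1'
        exact Or.inl (delete (by simpa using h₁) (by simpa using h₂))

/-- Let `w` be a word in two letters `i`, `j`. Either `w s_i` is represented by a word shorter than
`w`, or `w a_i` and its coroot are non-negative integral combinations. -/
theorem rankTwo_word {i j : ι} (hij : i ≠ j) (L : List ι) (hL : ∀ k ∈ L, k = i ∨ k = j) :
    (∃ L' : List ι, L'.length < L.length ∧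
      R.wordProd L' = R.wordProd L * R.simpleReflection i) ∨
    ∃ x y y' : ℕ,
      R.wordProd L (R.simpleRoot i) = x • R.simpleRoot i + y • R.simpleRoot j ∧
      dualAct (R.wordProd L) (R.simpleCoroot i) = x • R.simpleCoroot i + y' • R.simpleCoroot j := by
  obtain ⟨a, b, c, d, hb, hc, hd, hcd, hji, hij⟩ := R.exists_rankTwo_symmetrization hij
  refine (R.rankTwo_word_aux hb hc hd hcd hji hij L hL).imp_right ?_
  rintro ⟨x, y, y', hx, hy, hy', -, -, h₁, h₂⟩
  lift x to ℕ using hx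
  lift y to ℕ using hy
  lift y' to ℕ using hy'
  exact ⟨x, y, y', by simpa [Nat.cast_smul_eq_nsmul] using h₁,
    by simpa [Nat.cast_smul_eq_nsmul] using h₂⟩

/-! ### Positivity of roots and coroots -/

/-- The non-negative integral combinations of the simple roots. -/
def rootCone : AddSubmonoid V := AddSubmonoid.closure (Set.range R.simpleRoot)

/-- The non-negative integral combinations of the simple coroots. -/
def corootCone : AddSubmonoid (Module.Dual ℝ V) :=
  AddSubmonoid.closure (Set.range R.simpleCoroot)

theorem simpleRoot_mem_rootCone (i : ι) : R.simpleRoot i ∈ R.rootCone :=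
  AddSubmonoid.subset_closure ⟨i, rfl⟩

theorem simpleCoroot_mem_corootCone (i : ι) : R.simpleCoroot i ∈ R.corootCone :=
  AddSubmonoid.subset_closure ⟨i, rfl⟩

/-- If `ℓ(g) ≤ ℓ(g s_i)` then `g a_i` and its coroot are positive. The element `g` is factored as
`v u` with `u` in the subgroup generated by `s_i` and one further fundamental reflection and with
`v` as short as possible; this reduces the assertion to rank two and to the shorter element `v`. -/
theorem mem_cones_of_wordLength_le {g : V ≃ₗ[ℝ] V} (hg : g ∈ R.weylGroup) {i : ι}
    (hi : R.wordLength g ≤ R.wordLength (g * R.simpleReflection i)) :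
    g (R.simpleRoot i) ∈ R.rootCone ∧ dualAct g (R.simpleCoroot i) ∈ R.corootCone := by
  induction hn : R.wordLength g using Nat.strong_induction_on generalizing g i with
  | _ n ih =>
  subst hn
  obtain ⟨L, hLlen, hLg⟩ := R.exists_reduced_word hg
  rcases L.eq_nil_or_concat' with rfl | ⟨L₀, j, rfl⟩
  · rw [wordProd_nil] at hLg
    subst hLg
    exact ⟨R.simpleRoot_mem_rootCone i, R.simpleCoroot_mem_corootCone i⟩
  have hij : i ≠ j := by
    rintro rfl
    rw [← hLg, wordProd_append] at hi
    simp only [wordProd_cons, wordProd_nil, mul_one, mul_assoc, simpleReflection_mul_self] at hi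
    have := R.wordLength_wordProd_le L₀
    rw [wordProd_append, wordProd_cons, wordProd_nil, mul_one] at hLg
    rw [hLg, ← hLlen, List.length_append, List.length_singleton] at hi
    lia
  let P : ℕ → Prop := fun m => ∃ v ∈ R.weylGroup, ∃ L : List ι, (∀ k ∈ L, k = i ∨ k = j) ∧
    v * R.wordProd L = g ∧ R.wordLength v + L.length = R.wordLength g ∧ R.wordLength v = m
  have hP : P (R.wordLength (R.wordProd L₀)) := by
    refine ⟨_, R.wordProd_mem L₀, [j], by simp, by simpa using hLg, ?_, rfl⟩
    have h1 := R.wordLength_wordProd_le L₀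
    have h2 := R.wordLength_mul_wordProd_le (R.wordProd_mem L₀) [j]
    rw [← wordProd_append, hLg] at h2
    simp only [List.length_append, List.length_singleton] at hLlen h2 ⊢
    lia
  classical
  have hex : ∃ m, P m := ⟨_, hP⟩
  obtain ⟨v, hv, M, hM, hvM, hlen, hmin⟩ := Nat.find_spec hex
  have hvlt : R.wordLength v < R.wordLength g := by
    have h1 := R.wordLength_wordProd_le L₀
    have := Nat.find_min' hex hP
    simp only [List.length_append, List.length_singleton] at hLlen
    lia
  have hvk (k : ι) (hk : k = i ∨ k = j) :
      R.wordLength v ≤ R.wordLength (v * R.simpleReflection k) := by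
    by_contra! hlt
    have hmem := mul_mem hv (R.simpleReflection_mem k)
    have heq : v * R.simpleReflection k * R.wordProd (k :: M) = g := by
      rw [wordProd_cons, mul_assoc, ← mul_assoc (R.simpleReflection k), simpleReflection_mul_self,
        one_mul, hvM]
    have h1 := R.wordLength_mul_wordProd_le hmem (k :: M)
    rw [heq] at h1
    simp only [List.length_cons] at h1
    refine Nat.find_min hex (m := R.wordLength (v * R.simpleReflection k)) (by lia)
      ⟨_, hmem, k :: M, ?_, heq, ?_, rfl⟩
    · simpa [hk] using hM
    · simp only [List.length_cons]; lia
  obtain ⟨hi₁, hi₂⟩ := ih _ hvlt hv (hvk i (Or.inl rfl)) rfl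
  obtain ⟨hj₁, hj₂⟩ := ih _ hvlt hv (hvk j (Or.inr rfl)) rfl
  rcases R.rankTwo_word hij M hM with ⟨L', hL', hL''⟩ | ⟨x, y, y', h₁, h₂⟩
  · have h1 := R.wordLength_mul_wordProd_le hv L'
    rw [hL'', ← mul_assoc, hvM] at h1
    lia
  · rw [← hvM]
    refine ⟨?_, ?_⟩
    · rw [LinearEquiv.mul_apply, h₁, map_add, map_nsmul, map_nsmul]
      exact add_mem (nsmul_mem hi₁ x) (nsmul_mem hj₁ y)
    · rw [dualAct_mul, h₂, map_add, map_nsmul, map_nsmul]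
      exact add_mem (nsmul_mem hi₂ x) (nsmul_mem hj₂ y')

theorem neg_mem_cones_of_wordLength_lt {g : V ≃ₗ[ℝ] V} (hg : g ∈ R.weylGroup) {i : ι}
    (hi : R.wordLength (g * R.simpleReflection i) < R.wordLength g) :
    -g (R.simpleRoot i) ∈ R.rootCone ∧ -dualAct g (R.simpleCoroot i) ∈ R.corootCone := by
  have := R.mem_cones_of_wordLength_le (mul_mem hg (R.simpleReflection_mem i)) (i := i)
    (by rw [mul_assoc, simpleReflection_mul_self, mul_one]; exact hi.le)
  rwa [LinearEquiv.mul_apply, simpleReflection_simpleRoot, dualAct_mul,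
    dualAct_simpleReflection_simpleCoroot, map_neg, map_neg] at this

/-- Every real root is positive or negative, and its coroot has the same sign. -/
theorem mem_cones_or_neg_mem_cones {g : V ≃ₗ[ℝ] V} (hg : g ∈ R.weylGroup) (i : ι) :
    (g (R.simpleRoot i) ∈ R.rootCone ∧ dualAct g (R.simpleCoroot i) ∈ R.corootCone) ∨
    (-g (R.simpleRoot i) ∈ R.rootCone ∧ -dualAct g (R.simpleCoroot i) ∈ R.corootCone) :=
  (le_or_gt _ _).imp (R.mem_cones_of_wordLength_le hg) (R.neg_mem_cones_of_wordLength_lt hg)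

end KacMoodyRootSystem

/-! ### Non-negative integral combinations of independent vectors -/

section Cone

variable {ι M : Type*} [AddCommGroup M] {v : ι → M}

theorem AddSubmonoid.exists_linearCombination_of_mem_closure_range {x : M}
    (hx : x ∈ AddSubmonoid.closure (Set.range v)) :
    ∃ n : ι →₀ ℕ, Finsupp.linearCombination ℕ v n = x := by
  induction hx using AddSubmonoid.closure_induction with
  | mem x hx => obtain ⟨i, rfl⟩ := hx; exact ⟨Finsupp.single i 1, by simp⟩
  | zero => exact ⟨0, by simp⟩
  | add x y _ _ hx hy =>
    obtain ⟨m, rfl⟩ := hx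
    obtain ⟨n, rfl⟩ := hy
    exact ⟨m + n, by simp⟩

variable [Module ℝ M]

theorem LinearIndependent.exists_coordinates (hv : LinearIndependent ℝ v) :
    ∃ φ : M →ₗ[ℝ] (ι →₀ ℝ), ∀ i, φ (v i) = Finsupp.single i 1 := by
  obtain ⟨φ, hφ⟩ := (Finsupp.linearCombination ℝ v).exists_leftInverse_of_injective
    (LinearMap.ker_eq_bot.2 hv)
  refine ⟨φ, fun i => ?_⟩
  simpa using LinearMap.congr_fun hφ (Finsupp.single i 1)

theorem coordinates_linearCombination {φ : M →ₗ[ℝ] (ι →₀ ℝ)}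
    (hφ : ∀ i, φ (v i) = Finsupp.single i 1) (n : ι →₀ ℕ) (i : ι) :
    φ (Finsupp.linearCombination ℕ v n) i = n i := by
  induction n using Finsupp.induction_linear with
  | zero => simp
  | add f g hf hg => simp [hf, hg]
  | single j k =>
    classical
    simp [hφ, Finsupp.single_apply]

theorem LinearIndependent.eq_zero_of_mem_of_neg_mem (hv : LinearIndependent ℝ v) {x : M}
    (hx : x ∈ AddSubmonoid.closure (Set.range v))
    (hx' : -x ∈ AddSubmonoid.closure (Set.range v)) : x = 0 := by
  obtain ⟨φ, hφ⟩ := hv.exists_coordinates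
  obtain ⟨n, rfl⟩ := AddSubmonoid.exists_linearCombination_of_mem_closure_range hx
  obtain ⟨m, hm⟩ := AddSubmonoid.exists_linearCombination_of_mem_closure_range hx'
  have h : n = 0 := by
    ext i
    have h1 := coordinates_linearCombination hφ m i
    rw [hm, map_neg, Finsupp.neg_apply, coordinates_linearCombination hφ n i] at h1
    have h2 : (m i + n i : ℝ) = 0 := by linarith
    have h3 : m i + n i = 0 := by exact_mod_cast h2
    simpa using (Nat.add_eq_zero_iff.1 h3).2
  simp [h]

end Cone

namespace KacMoodyRootSystem

variable {ι V : Type*} [AddCommGroup V] [Module ℝ V] (R : KacMoodyRootSystem ι V)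

variable {R} in
theorem eq_zero_of_mem_rootCone {x : V} (hx : x ∈ R.rootCone) (hx' : -x ∈ R.rootCone) : x = 0 :=
  R.linearIndependent_simpleRoot.eq_zero_of_mem_of_neg_mem hx hx'

variable {R} in
theorem eq_zero_of_mem_corootCone {x : Module.Dual ℝ V} (hx : x ∈ R.corootCone)
    (hx' : -x ∈ R.corootCone) : x = 0 :=
  R.linearIndependent_simpleCoroot.eq_zero_of_mem_of_neg_mem hx hx'

theorem apply_simpleRoot_ne_zero (g : V ≃ₗ[ℝ] V) (i : ι) : g (R.simpleRoot i) ≠ 0 := by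
  simpa using R.linearIndependent_simpleRoot.ne_zero i

theorem neg_simpleCoroot_notMem (i : ι) : -R.simpleCoroot i ∉ R.corootCone := fun h =>
  R.linearIndependent_simpleCoroot.ne_zero i
    (eq_zero_of_mem_corootCone (R.simpleCoroot_mem_corootCone i) h)

theorem dualAct_mem_corootCone {g : V ≃ₗ[ℝ] V} (hg : g ∈ R.weylGroup) {i : ι}
    (h : g (R.simpleRoot i) ∈ R.rootCone) : dualAct g (R.simpleCoroot i) ∈ R.corootCone := by
  rcases R.mem_cones_or_neg_mem_cones hg i with h' | h'
  · exact h'.2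
  · exact absurd (eq_zero_of_mem_rootCone h h'.1) (R.apply_simpleRoot_ne_zero g i)

/-- The fundamental reflection `s_i` permutes the positive real roots other than `a_i`. -/
theorem simpleReflection_mem_rootCone {g : V ≃ₗ[ℝ] V} (hg : g ∈ R.weylGroup) {i k : ι}
    (h : g (R.simpleRoot k) ∈ R.rootCone) (hne : g (R.simpleRoot k) ≠ R.simpleRoot i) :
    R.simpleReflection i (g (R.simpleRoot k)) ∈ R.rootCone := by
  rcases R.mem_cones_or_neg_mem_cones (mul_mem (R.simpleReflection_mem i) hg) k with h' | h'
  · exact h'.1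
  exfalso
  replace h' := h'.1
  rw [LinearEquiv.mul_apply] at h'
  obtain ⟨φ, hφ⟩ := R.linearIndependent_simpleRoot.exists_coordinates
  obtain ⟨n, hn⟩ := AddSubmonoid.exists_linearCombination_of_mem_closure_range h
  obtain ⟨m, hm⟩ := AddSubmonoid.exists_linearCombination_of_mem_closure_range h'
  -- `s_i` changes only the coefficient at `a_i`, so all the others vanish
  have hn0 : n = Finsupp.single i (n i) := by
    ext j
    by_cases hj : j = i
    · subst hj; simp
    have h1 := coordinates_linearCombination hφ m j
    have h2 := coordinates_linearCombination hφ n j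
    rw [hm, simpleReflection_apply] at h1
    rw [hn] at h2
    simp only [map_neg, map_sub, map_smul, hφ, Finsupp.neg_apply, Finsupp.sub_apply,
      Finsupp.smul_apply, h2, Finsupp.single_eq_of_ne hj, smul_zero, sub_zero] at h1
    have h3 : (m j + n j : ℝ) = 0 := by linarith
    have h4 : m j + n j = 0 := by exact_mod_cast h3
    rw [Finsupp.single_eq_of_ne hj]
    exact (Nat.add_eq_zero_iff.1 h4).2
  rw [hn0, Finsupp.linearCombination_single] at hn
  -- the remaining coefficient divides `1`, since `g⁻¹` preserves integrality
  have hk : R.simpleRoot k = n i • g⁻¹ (R.simpleRoot i) := by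
    rw [← map_nsmul, hn]
    exact (g.symm_apply_apply _).symm
  have hdvd : n i ∣ 1 := by
    have key (x : V) (hx : x ∈ R.rootCone) (ε : ℤ)
        (hkx : R.simpleRoot k = (n i : ℝ) • (ε : ℝ) • x) : n i ∣ 1 := by
      obtain ⟨p, rfl⟩ := AddSubmonoid.exists_linearCombination_of_mem_closure_range hx
      have h1 := DFunLike.congr_fun (congrArg φ hkx) k
      rw [hφ, Finsupp.single_eq_same, map_smul, map_smul, Finsupp.smul_apply, Finsupp.smul_apply,
        coordinates_linearCombination hφ] at h1
      simp only [smul_eq_mul] at h1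
      have h2 : (1 : ℤ) = n i * (ε * p k) := by exact_mod_cast h1
      exact Int.natCast_dvd_natCast.1 ⟨_, by simpa using h2⟩
    rcases R.mem_cones_or_neg_mem_cones (inv_mem hg) i with h1 | h1
    · exact key _ h1.1 1 (by simpa [Nat.cast_smul_eq_nsmul] using hk)
    · exact key _ h1.1 (-1) (by simpa [Nat.cast_smul_eq_nsmul] using hk)
  rw [Nat.dvd_one.1 hdvd, one_smul] at hn
  exact hne hn.symm

theorem neg_mem_realRoots {b : V} (hb : b ∈ R.realRoots) : -b ∈ R.realRoots := by
  obtain ⟨w, i, rfl⟩ := hb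
  exact ⟨w * ⟨_, R.simpleReflection_mem i⟩, i, by simp [simpleReflection_simpleRoot]⟩

theorem apply_mem_realRoots {g : V ≃ₗ[ℝ] V} (hg : g ∈ R.weylGroup) {b : V}
    (hb : b ∈ R.realRoots) : g b ∈ R.realRoots := by
  obtain ⟨w, i, rfl⟩ := hb
  exact ⟨⟨g, hg⟩ * w, i, by simp⟩

/-! ### Inversions -/

/-- The set `Φ(g)`, as a set of vectors. -/
def inversions (g : V ≃ₗ[ℝ] V) : Set V := {b | b ∈ R.posRealRoots ∧ -g.symm b ∈ R.rootCone}

theorem mem_inversionSet_iff (w : R.weylGroup) (b : R.posRealRoots) :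
    b ∈ R.inversionSet w ↔ (b : V) ∈ R.inversions (w : V ≃ₗ[ℝ] V) := by
  refine ⟨fun h => ⟨b.2, h.2⟩, fun h => ⟨?_, h.2⟩⟩
  exact R.neg_mem_realRoots (R.apply_mem_realRoots (inv_mem w.2) b.2.1)

theorem simpleReflection_mem_posRealRoots {b : V} (hb : b ∈ R.posRealRoots) {i : ι}
    (hne : b ≠ R.simpleRoot i) : R.simpleReflection i b ∈ R.posRealRoots := by
  refine ⟨R.apply_mem_realRoots (R.simpleReflection_mem i) hb.1, ?_⟩
  obtain ⟨⟨w, k, rfl⟩, hb⟩ := hb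
  exact R.simpleReflection_mem_rootCone w.2 hb hne

theorem simpleReflection_mul_symm_apply (i : ι) (g : V ≃ₗ[ℝ] V) (b : V) :
    (R.simpleReflection i * g).symm b = g.symm (R.simpleReflection i b) := by
  rw [← R.simpleReflection_symm i]; rfl

theorem inversions_simpleReflection_mul_subset (i : ι) (g : V ≃ₗ[ℝ] V) :
    R.inversions (R.simpleReflection i * g) ⊆
      insert (R.simpleRoot i) (R.simpleReflection i '' R.inversions g) := by
  rintro b ⟨hb, hb'⟩
  by_cases hne : b = R.simpleRoot i
  · exact Or.inl hne
  · refine Or.inr ⟨R.simpleReflection i b, ⟨R.simpleReflection_mem_posRealRoots hb hne, ?_⟩,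
      R.simpleReflection_simpleReflection i b⟩
    rwa [simpleReflection_mul_symm_apply] at hb'

theorem finite_inversions {g : V ≃ₗ[ℝ] V} (hg : g ∈ R.weylGroup) : (R.inversions g).Finite := by
  obtain ⟨L, rfl⟩ := R.exists_wordProd_eq hg
  clear hg
  induction L with
  | nil =>
    refine Set.Finite.subset Set.finite_empty ?_
    rintro b ⟨⟨⟨w, i, rfl⟩, hb⟩, hb'⟩
    exact R.apply_simpleRoot_ne_zero w i (eq_zero_of_mem_rootCone hb hb')
  | cons i L ih =>
    rw [wordProd_cons]
    exact ((ih.image _).insert _).subset (R.inversions_simpleReflection_mul_subset i _)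

theorem finite_inversionSet (w : R.weylGroup) : (R.inversionSet w).Finite := by
  have h : R.inversionSet w = Subtype.val ⁻¹' R.inversions (w : V ≃ₗ[ℝ] V) :=
    Set.ext (R.mem_inversionSet_iff w)
  rw [h]
  exact (R.finite_inversions w.2).preimage Subtype.val_injective.injOn

theorem wordLength_inv_le {g : V ≃ₗ[ℝ] V} (hg : g ∈ R.weylGroup) :
    R.wordLength g⁻¹ ≤ R.wordLength g := by
  obtain ⟨L, hL, rfl⟩ := R.exists_reduced_word hg
  have h : (R.wordProd L)⁻¹ = R.wordProd L.reverse := by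
    clear * -
    induction L with
    | nil => simp
    | cons i L ih => simp [← ih, simpleReflection_inv]
  rw [h, ← hL, ← List.length_reverse]
  exact R.wordLength_wordProd_le _

theorem wordLength_inv {g : V ≃ₗ[ℝ] V} (hg : g ∈ R.weylGroup) :
    R.wordLength g⁻¹ = R.wordLength g :=
  (R.wordLength_inv_le hg).antisymm (by simpa using R.wordLength_inv_le (inv_mem hg))

/-- If `s_i w` is longer than `w`, then `Φ(s_i w)` contains `a_i` as well as `s_i Φ(w)`. -/
theorem wordLength_le_ncard_inversions {g : V ≃ₗ[ℝ] V} (hg : g ∈ R.weylGroup) :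
    R.wordLength g ≤ (R.inversions g).ncard := by
  obtain ⟨L, hL, rfl⟩ := R.exists_reduced_word hg
  rw [← hL]
  clear hg
  induction L with
  | nil => simp
  | cons i L ih =>
    have hmem := R.wordProd_mem L
    have hlen : L.length = R.wordLength (R.wordProd L) := by
      have h1 := R.wordLength_wordProd_le L
      obtain ⟨M, hM, hML⟩ := R.exists_reduced_word hmem
      have h2 := R.wordLength_wordProd_le (i :: M)
      rw [wordProd_cons, hML, ← wordProd_cons, ← hL] at h2
      simp only [List.length_cons] at h2
      lia
    have hpos : (R.wordProd L)⁻¹ (R.simpleRoot i) ∈ R.rootCone := by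
      refine (R.mem_cones_of_wordLength_le (inv_mem hmem) ?_).1
      have h1 : (R.wordProd L)⁻¹ * R.simpleReflection i = (R.wordProd (i :: L))⁻¹ := by
        simp [simpleReflection_inv]
      rw [h1, R.wordLength_inv hmem, R.wordLength_inv (R.wordProd_mem _), ← hL, ← hlen]
      simp
    have hsub : insert (R.simpleRoot i) (R.simpleReflection i '' R.inversions (R.wordProd L)) ⊆
        R.inversions (R.wordProd (i :: L)) := by
      rw [wordProd_cons]
      refine Set.insert_subset ⟨⟨⟨1, i, rfl⟩, R.simpleRoot_mem_rootCone i⟩, ?_⟩ ?_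
      · rw [simpleReflection_mul_symm_apply, simpleReflection_simpleRoot, map_neg, neg_neg]
        exact hpos
      · rintro _ ⟨b, ⟨hb, hb'⟩, rfl⟩
        refine ⟨R.simpleReflection_mem_posRealRoots hb ?_, ?_⟩
        · rintro rfl
          exact R.apply_simpleRoot_ne_zero (R.wordProd L)⁻¹ i (eq_zero_of_mem_rootCone hpos hb')
        · rwa [simpleReflection_mul_symm_apply, simpleReflection_simpleReflection]
    have hnot : R.simpleRoot i ∉ R.simpleReflection i '' R.inversions (R.wordProd L) := by
      rintro ⟨b, ⟨hb, -⟩, hb'⟩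
      have h1 : b = -R.simpleRoot i := by
        rw [← simpleReflection_simpleRoot, ← hb', simpleReflection_simpleReflection]
      subst h1
      exact R.linearIndependent_simpleRoot.ne_zero i
        (eq_zero_of_mem_rootCone (R.simpleRoot_mem_rootCone i) hb.2)
    calc (i :: L).length = L.length + 1 := rfl
      _ ≤ (R.inversions (R.wordProd L)).ncard + 1 := by gcongr; exact ih hlen
      _ = (insert (R.simpleRoot i)
            (R.simpleReflection i '' R.inversions (R.wordProd L))).ncard := by
          rw [Set.ncard_insert_of_notMem hnot ((R.finite_inversions hmem).image _),
            Set.ncard_image_of_injective _ (R.simpleReflection i).injective]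
      _ ≤ _ := Set.ncard_le_ncard hsub (R.finite_inversions (R.wordProd_mem _))

theorem length_le_card_inversionSet (w : R.weylGroup) :
    R.length w ≤ (R.finite_inversionSet w).toFinset.card := by
  rw [length_eq_wordLength, ← Set.ncard_eq_toFinset_card _ (R.finite_inversionSet w),
    ← Set.ncard_image_of_injective _ Subtype.val_injective]
  refine (R.wordLength_le_ncard_inversions w.2).trans_eq (congrArg _ ?_)
  ext b
  exact ⟨fun hb => ⟨⟨b, hb.1⟩, (R.mem_inversionSet_iff w _).2 hb, rfl⟩,
    by rintro ⟨b, hb, rfl⟩; exact (R.mem_inversionSet_iff w _).1 hb⟩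

/-! ### Coroots of positive real roots -/

/-- The coroot of a positive real root. -/
noncomputable def posCoroot (b : R.posRealRoots) : Module.Dual ℝ V := R.coroot ⟨b, b.2.1⟩

theorem posCoroot_spec (b : R.posRealRoots) :
    ∃ g ∈ R.weylGroup, ∃ i, g (R.simpleRoot i) = (b : V) ∧
      R.posCoroot b = dualAct g (R.simpleCoroot i) := by
  obtain ⟨w, i, h⟩ := R.coroot_spec ⟨b, b.2.1⟩
  exact ⟨w, w.2, i, h⟩

theorem posCoroot_mem_corootCone (b : R.posRealRoots) : R.posCoroot b ∈ R.corootCone := by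
  obtain ⟨g, hg, i, h₁, h₂⟩ := R.posCoroot_spec b
  rw [h₂]
  exact R.dualAct_mem_corootCone hg (h₁ ▸ b.2.2)

theorem posCoroot_ne_zero (b : R.posRealRoots) : R.posCoroot b ≠ 0 := by
  obtain ⟨g, hg, i, h₁, h₂⟩ := R.posCoroot_spec b
  intro h
  have := dualAct_apply_self g (R.simpleCoroot i) (R.simpleRoot i)
  rw [← h₂, h, R.pairing_self] at this
  simp at this

/-- If `u` moves the simple coroot of `i` to that of `k`, it also moves the simple root of `i` to
that of `k`: otherwise `u a_i` and `s_k u a_i` are both positive, while the coroot of the latter is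
`-a_k^∨`. -/
theorem apply_simpleRoot_eq_of_dualAct_eq {u : V ≃ₗ[ℝ] V} (hu : u ∈ R.weylGroup) {i k : ι}
    (h : dualAct u (R.simpleCoroot i) = R.simpleCoroot k) :
    u (R.simpleRoot i) = R.simpleRoot k := by
  by_contra hne
  have hpos : u (R.simpleRoot i) ∈ R.rootCone := by
    rcases R.mem_cones_or_neg_mem_cones hu i with h' | h'
    · exact h'.1
    · exact absurd (h ▸ h'.2) (R.neg_simpleCoroot_notMem k)
  have := R.dualAct_mem_corootCone (mul_mem (R.simpleReflection_mem k) hu) (i := i)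
    (R.simpleReflection_mem_rootCone hu hpos hne)
  rw [dualAct_mul, h, dualAct_simpleReflection_simpleCoroot] at this
  exact R.neg_simpleCoroot_notMem k this

theorem posCoroot_injective : Function.Injective R.posCoroot := by
  intro b c hbc
  obtain ⟨g, hg, i, h₁, h₂⟩ := R.posCoroot_spec b
  obtain ⟨h, hh, k, h₃, h₄⟩ := R.posCoroot_spec c
  have key := R.apply_simpleRoot_eq_of_dualAct_eq (mul_mem (inv_mem hh) hg) (i := i) (k := k) (by
    rw [dualAct_mul, ← h₂, hbc, h₄, ← dualAct_mul, inv_mul_cancel, dualAct_one])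
  refine Subtype.ext ?_
  rw [← h₁, ← h₃, ← key, ← LinearEquiv.mul_apply, mul_inv_cancel_left]

/-- The coefficients of the coroot of a positive real root with respect to the simple coroots. -/
noncomputable def corootCoeff (b : R.posRealRoots) : ι →₀ ℕ :=
  (AddSubmonoid.exists_linearCombination_of_mem_closure_range
    (R.posCoroot_mem_corootCone b)).choose

theorem linearCombination_corootCoeff (b : R.posRealRoots) :
    Finsupp.linearCombination ℕ R.simpleCoroot (R.corootCoeff b) = R.posCoroot b :=
  (AddSubmonoid.exists_linearCombination_of_mem_closure_range
    (R.posCoroot_mem_corootCone b)).choose_spec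

theorem corootCoeff_injective : Function.Injective R.corootCoeff := fun b c h =>
  R.posCoroot_injective (by rw [← linearCombination_corootCoeff, h, linearCombination_corootCoeff])

theorem corootCoeff_ne_zero (b : R.posRealRoots) : R.corootCoeff b ≠ 0 := fun h =>
  R.posCoroot_ne_zero b (by rw [← linearCombination_corootCoeff, h, map_zero])

end KacMoodyRootSystem

/-! ### Holomorphic functions of several variables -/

section SeveralVariables

open Metric Filter Topology

variable {E : Type*} [NormedAddCommGroup E] [NormedSpace ℂ E]

/-- Cauchy's estimate for the Fréchet derivative, obtained by restriction to complex lines. The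
factor `2` comes from keeping the circles inside the open ball. -/
theorem norm_fderiv_le_of_forall_mem_ball_norm_le {f : E → ℂ} {x : E} {r C : ℝ} (hr : 0 < r)
    (hd : DifferentiableOn ℂ f (ball x r)) (hC : ∀ z ∈ ball x r, ‖f z‖ ≤ C) :
    ‖fderiv ℂ f x‖ ≤ 2 * C / r := by
  have hC0 : 0 ≤ C := (norm_nonneg _).trans (hC x (mem_ball_self hr))
  refine ContinuousLinearMap.opNorm_le_bound _ (by positivity) fun v => ?_
  rcases eq_or_ne v 0 with rfl | hv
  · simp
  have hv' : 0 < ‖v‖ := norm_pos_iff.2 hv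
  set R := r / (2 * ‖v‖) with hR
  have hR0 : 0 < R := by positivity
  have hRv : R * ‖v‖ = r / 2 := by rw [hR]; field_simp
  have hline : Set.MapsTo (fun z : ℂ => x + z • v) (closedBall 0 R) (ball x r) := by
    intro z hz
    rw [mem_closedBall_zero_iff] at hz
    rw [mem_ball, dist_eq_norm, add_sub_cancel_left, norm_smul]
    nlinarith [mul_le_mul_of_nonneg_right hz hv'.le]
  have haff (z : ℂ) : HasDerivAt (fun z : ℂ => x + z • v) v z := by
    simpa using ((hasDerivAt_id z).smul_const v).const_add x
  have hg : DifferentiableOn ℂ (fun z : ℂ => f (x + z • v)) (closedBall 0 R) :=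
    hd.comp (fun z _ => (haff z).differentiableAt.differentiableWithinAt) hline
  have hx : DifferentiableAt ℂ f x := hd.differentiableAt (ball_mem_nhds x hr)
  have hderiv : deriv (fun z : ℂ => f (x + z • v)) 0 = fderiv ℂ f x v := by
    have h1 : HasFDerivAt f (fderiv ℂ f x) (x + (0 : ℂ) • v) := by simpa using hx.hasFDerivAt
    exact (h1.comp_hasDerivAt (0 : ℂ) (haff 0)).deriv
  have := Complex.norm_deriv_le_of_forall_mem_sphere_norm_le hR0
    (hg.diffContOnCl_ball subset_rfl)
    (fun z hz => hC _ (hline (sphere_subset_closedBall hz)))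
  rw [hderiv] at this
  refine this.trans_eq ?_
  rw [hR]
  field_simp

/-- Weierstrass' theorem in several variables: a uniform limit of holomorphic functions on a ball
is holomorphic. The derivatives converge uniformly on a smaller ball by Cauchy's estimate. -/
theorem TendstoUniformlyOn.differentiableAt_of_ball {α : Type*} {l : Filter α} [l.NeBot]
    {F : α → E → ℂ} {f : E → ℂ} {x : E} {r : ℝ} (hr : 0 < r)
    (hF : ∀ n, DifferentiableOn ℂ (F n) (ball x r))
    (h : TendstoUniformlyOn F f l (ball x r)) : DifferentiableAt ℂ f x := by
  have hr2 : 0 < r / 2 := by positivity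
  have hsub {y : E} (hy : y ∈ ball x (r / 2)) : ball y (r / 2) ⊆ ball x r :=
    ball_subset_ball' (by rw [mem_ball] at hy; linarith)
  have hdiff (n : α) {y : E} (hy : y ∈ ball x (r / 2)) : DifferentiableAt ℂ (F n) y :=
    (hF n).differentiableAt (mem_of_superset (ball_mem_nhds y hr2) (hsub hy))
  have hC : UniformCauchySeqOn (fun n => fderiv ℂ (F n)) l (ball x (r / 2)) := by
    intro s hs
    obtain ⟨ε, hε, hεs⟩ := mem_uniformity_dist.1 hs
    filter_upwards [h.uniformCauchySeqOn _ (dist_mem_uniformity (ε := ε * r / 8) (by positivity))]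
      with n hn y hy
    refine hεs ?_
    rw [dist_eq_norm, ← fderiv_sub (hdiff n.1 hy) (hdiff n.2 hy)]
    refine (norm_fderiv_le_of_forall_mem_ball_norm_le (C := ε * r / 8) hr2
      (((hF n.1).mono (hsub hy)).sub ((hF n.2).mono (hsub hy))) fun z hz => ?_).trans_lt ?_
    · rw [Pi.sub_apply, ← dist_eq_norm]
      exact (hn z (hsub hy hz)).le
    · have : 2 * (ε * r / 8) / (r / 2) = ε / 2 := by field_simp; norm_num
      rw [this]
      linarith
  have hlim (y : E) : ∃ g' : E →L[ℂ] ℂ, y ∈ ball x (r / 2) →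
      Tendsto (fun n => fderiv ℂ (F n) y) l (𝓝 g') := by
    by_cases hy : y ∈ ball x (r / 2)
    · obtain ⟨g', hg'⟩ := CompleteSpace.complete (hC.cauchy_map hy)
      exact ⟨g', fun _ => hg'⟩
    · exact ⟨0, fun h => absurd h hy⟩
  choose g' hg' using hlim
  refine (hasFDerivAt_of_tendstoUniformlyOn isOpen_ball (hC.tendstoUniformlyOn_of_tendsto hg')
    (fun n y hy => (hdiff n hy).hasFDerivAt) (fun y hy => h.tendsto_at ?_)
    (mem_ball_self hr2)).differentiableAt
  exact ball_subset_ball (by linarith) hy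

theorem differentiableOn_of_forall_isCompact_tendstoUniformlyOn [ProperSpace E] {α : Type*}
    {l : Filter α} [l.NeBot] {F : α → E → ℂ} {f : E → ℂ} {U : Set E} (hU : IsOpen U)
    (hF : ∀ n, DifferentiableOn ℂ (F n) U)
    (h : ∀ K ⊆ U, IsCompact K → TendstoUniformlyOn F f l K) : DifferentiableOn ℂ f U := by
  intro x hx
  obtain ⟨r, hr, hrU⟩ := nhds_basis_closedBall.mem_iff.1 (hU.mem_nhds hx)
  exact (TendstoUniformlyOn.differentiableAt_of_ball hr
    (fun n => (hF n).mono (ball_subset_closedBall.trans hrU))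
    ((h _ hrU (isCompact_closedBall x r)).mono ball_subset_closedBall)).differentiableWithinAt

theorem differentiableOn_finsetProd {κ : Type*} {f : κ → E → ℂ} {U : Set E} (s : Finset κ)
    (h : ∀ i, DifferentiableOn ℂ (f i) U) : DifferentiableOn ℂ (fun x => ∏ i ∈ s, f i x) U := by
  classical
  induction s using Finset.induction_on with
  | empty => simp
  | insert i s hi ih => simpa only [Finset.prod_insert hi] using (h i).fun_mul ih

end SeveralVariables

/-! ### Geometric estimates -/

theorem summable_pow_degree {ι : Type*} [Finite ι] {q : ℝ} (hq : 0 ≤ q) (hq' : q < 1) :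
    Summable fun n : ι →₀ ℕ => q ^ n.degree := by
  classical
  have := Fintype.ofFinite ι
  refine (Equiv.summable_iff Finsupp.equivFunOnFinite.symm).1 ?_
  refine summable_of_sum_le (c := ∏ _i : ι, (1 - q)⁻¹) (fun n => pow_nonneg hq _) fun s => ?_
  let N := s.sup fun n => ∑ i, n i
  have hs : s ⊆ Fintype.piFinset fun _ => Finset.range (N + 1) := by
    intro n hn
    rw [Fintype.mem_piFinset]
    intro i
    have h1 : n i ≤ ∑ i, n i := Finset.single_le_sum (fun _ _ => Nat.zero_le _) (Finset.mem_univ i)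
    have h2 : ∑ i, n i ≤ N := Finset.le_sup (f := fun n : ι → ℕ => ∑ i, n i) hn
    rw [Finset.mem_range]
    lia
  calc ∑ n ∈ s, ((fun n : ι →₀ ℕ => q ^ n.degree) ∘ Finsupp.equivFunOnFinite.symm) n
      = ∑ n ∈ s, ∏ i, q ^ n i := by
        refine Finset.sum_congr rfl fun n _ => ?_
        simp [Finsupp.degree_eq_sum, Finset.prod_pow_eq_pow_sum]
    _ ≤ ∑ n ∈ Fintype.piFinset fun _ => Finset.range (N + 1), ∏ i, q ^ n i :=
        Finset.sum_le_sum_of_subset_of_nonneg hs fun n _ _ => by positivity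
    _ = ∏ _i : ι, ∑ k ∈ Finset.range (N + 1), q ^ k := (Finset.prod_univ_sum _ _).symm
    _ ≤ ∏ _i : ι, (1 - q)⁻¹ := by
        refine Finset.prod_le_prod (fun i _ => by positivity) fun i _ => ?_
        rw [← tsum_geometric_of_lt_one hq hq']
        exact (summable_geometric_of_lt_one hq hq').sum_le_tsum _ fun _ _ => by positivity

theorem norm_sub_div_one_sub_mul_le {t e : ℂ} {ρ u q : ℝ} (hρ : 0 < ρ) (hρ' : ρ ≤ 1)
    (ht : ‖t‖ ≤ ρ) (he : ‖e‖ ≤ u) (hu : u ≤ q) (hq : q < 1) :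
    ‖(t - e) / (1 - t * e)‖ ≤ ρ * (1 + (1 + ρ⁻¹) / (1 - q) * u) := by
  have hu0 : 0 ≤ u := (norm_nonneg e).trans he
  have hte : ‖t * e‖ ≤ u := by
    rw [norm_mul]
    nlinarith [norm_nonneg e, norm_nonneg t]
  have hden : 1 - u ≤ ‖1 - t * e‖ := by
    have := norm_sub_norm_le (1 : ℂ) (t * e)
    rw [norm_one] at this
    linarith
  have hnum : ‖t - e‖ ≤ ρ + u := (norm_sub_le t e).trans (add_le_add ht he)
  have h1u : 0 < 1 - u := by linarith
  have h1q : 0 < 1 - q := by linarith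
  rw [norm_div, div_le_iff₀ (h1u.trans_le hden)]
  have hC : 1 + ρ⁻¹ ≤ (1 + ρ⁻¹) / (1 - q) * (1 - u) := by
    rw [div_mul_eq_mul_div, le_div_iff₀ h1q]
    exact mul_le_mul_of_nonneg_left (by linarith) (by positivity)
  have hρρ : ρ * ρ⁻¹ = 1 := mul_inv_cancel₀ hρ.ne'
  calc ‖t - e‖ ≤ ρ + u := hnum
    _ = ρ * (1 - u) + ρ * ((1 + ρ⁻¹) * u) := by linear_combination (-u) * hρρ
    _ ≤ ρ * (1 - u) + ρ * ((1 + ρ⁻¹) / (1 - q) * (1 - u) * u) := by gcongr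
    _ = ρ * (1 + (1 + ρ⁻¹) / (1 - q) * u) * (1 - u) := by ring
    _ ≤ _ := by gcongr

theorem one_sub_ne_zero_of_norm_lt_one {z : ℂ} (hz : ‖z‖ < 1) : 1 - z ≠ 0 := by
  intro h
  rw [← sub_eq_zero.1 h, norm_one] at hz
  exact lt_irrefl _ hz

theorem norm_one_sub_mul_div_one_sub_sub_one_le {t e : ℂ} {u q : ℝ} (ht : ‖t‖ ≤ 1)
    (he : ‖e‖ ≤ u) (hu : u ≤ q) (hq : q < 1) :
    ‖(1 - t * e) / (1 - e) - 1‖ ≤ 2 / (1 - q) * u := by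
  have hne : 1 - e ≠ 0 := one_sub_ne_zero_of_norm_lt_one (by linarith)
  have hden : 1 - q ≤ ‖1 - e‖ := by
    have := norm_sub_norm_le (1 : ℂ) e
    rw [norm_one] at this
    linarith
  have h1q : 0 < 1 - q := by linarith
  have h1 : (1 - t * e) / (1 - e) - 1 = (1 - t) * e / (1 - e) := by field_simp; ring
  have h2 : ‖1 - t‖ ≤ 2 := (norm_sub_le _ _).trans (by rw [norm_one]; linarith)
  rw [h1, norm_div, norm_mul, div_mul_eq_mul_div]
  have hu0 : 0 ≤ u := (norm_nonneg e).trans he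
  gcongr

/-! ### The tube domain -/

namespace Complexification

variable {V : Type*} [AddCommGroup V] [Module ℝ V]

theorem exists_eq_mk (h : Complexification V) : ∃ x y : V, h = mk x y := by
  have h0 : (0 : Complexification V) = mk 0 0 := by simp [mk]; rfl
  induction h using TensorProduct.induction_on with
  | zero => exact ⟨0, 0, h0⟩
  | tmul z v =>
    refine ⟨z.re • v, z.im • v, ?_⟩
    simp only [mk, ← TensorProduct.smul_tmul, ← TensorProduct.add_tmul]
    congr 1
    apply Complex.ext <;> simp
  | add h₁ h₂ ih₁ ih₂ =>
    obtain ⟨x₁, y₁, rfl⟩ := ih₁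
    obtain ⟨x₂, y₂, rfl⟩ := ih₂
    refine ⟨x₁ + x₂, y₁ + y₂, ?_⟩
    simp only [mk, TensorProduct.tmul_add]
    exact add_add_add_comm _ _ _ _

/-- The pairing with a fixed element of the dual, as a complex-linear map. -/
noncomputable def pairingLinearMap (l : Module.Dual ℝ V) : Complexification V →ₗ[ℂ] ℂ :=
  Module.Dual.baseChange ℂ l

theorem differentiable_pairing [Module.Finite ℝ V] (l : Module.Dual ℝ V) :
    Differentiable ℂ fun h : Complexification V => h.pairing l :=
  (pairingLinearMap l).toContinuousLinearMap.differentiable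

end Complexification

namespace KacMoodyRootSystem

variable {ι V : Type*} [AddCommGroup V] [Module ℝ V] (R : KacMoodyRootSystem ι V)

theorem mem_tube_iff (h : Complexification V) :
    h ∈ R.tube ↔ ∀ i, 0 < (h.pairing (R.simpleCoroot i)).im := by
  constructor
  · rintro ⟨x, y, hy, rfl⟩ i
    simpa [Complexification.pairing_mk] using hy i
  · intro hh
    obtain ⟨x, y, rfl⟩ := h.exists_eq_mk
    exact ⟨x, y, fun i => by simpa [Complexification.pairing_mk] using hh i, rfl⟩

theorem isOpen_tube [Finite ι] [Module.Finite ℝ V] : IsOpen R.tube := by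
  have : R.tube = ⋂ i, {h | 0 < (h.pairing (R.simpleCoroot i)).im} := by
    ext h
    simp [mem_tube_iff]
  rw [this]
  exact isOpen_iInter_of_finite fun i => isOpen_lt continuous_const
    (Complex.continuous_im.comp (Complexification.differentiable_pairing _).continuous)

theorem differentiable_expCoroot [Module.Finite ℝ V] (b : R.posRealRoots) :
    Differentiable ℂ fun h => R.expCoroot h b :=
  ((Complexification.differentiable_pairing _).const_mul _).cexp

/-- The exponential of a coroot decays geometrically in the height of the coroot. -/
theorem norm_expCoroot_le {h : Complexification V} {δ : ℝ}
    (hδ : ∀ i, δ ≤ (h.pairing (R.simpleCoroot i)).im) (b : R.posRealRoots) :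
    ‖R.expCoroot h b‖ ≤ Real.exp (-(2 * Real.pi * δ)) ^ (R.corootCoeff b).degree := by
  obtain ⟨x, y, rfl⟩ := h.exists_eq_mk
  simp only [Complexification.pairing_mk, Complex.add_im, Complex.ofReal_im, Complex.mul_im,
    Complex.ofReal_re, Complex.I_re, Complex.I_im, mul_zero, mul_one, zero_add, add_zero] at hδ
  have key (n : ι →₀ ℕ) : n.degree * δ ≤ Finsupp.linearCombination ℕ R.simpleCoroot n y := by
    induction n using Finsupp.induction_linear with
    | zero => simp
    | add f g hf hg =>
      rw [map_add, map_add, LinearMap.add_apply]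
      push_cast
      linarith
    | single i k =>
      simp only [Finsupp.degree_single, Finsupp.linearCombination_single, LinearMap.smul_apply,
        nsmul_eq_mul]
      exact mul_le_mul_of_nonneg_left (hδ i) (Nat.cast_nonneg k)
  have hb := key (R.corootCoeff b)
  rw [linearCombination_corootCoeff] at hb
  change ‖Complex.exp (2 * Real.pi * Complex.I *
    (Complexification.mk x y).pairing (R.posCoroot b))‖ ≤ _
  rw [Complex.norm_exp, ← Real.exp_nat_mul, Real.exp_le_exp, Complexification.pairing_mk]
  have : (2 * Real.pi * Complex.I * ((R.posCoroot b x : ℂ) + (R.posCoroot b y : ℂ) * Complex.I)).re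
      = -(2 * Real.pi * R.posCoroot b y) := by
    simp
  rw [this]
  nlinarith [mul_le_mul_of_nonneg_left hb Real.two_pi_pos.le]

theorem exists_pos_forall_le_im_pairing [Finite ι] [Module.Finite ℝ V]
    {K : Set (Complexification V)} (hK : IsCompact K) (hKt : K ⊆ R.tube) :
    ∃ δ : ℝ, 0 < δ ∧ ∀ h ∈ K, ∀ i, δ ≤ (h.pairing (R.simpleCoroot i)).im := by
  have hex (i : ι) : ∃ δ : ℝ, 0 < δ ∧ ∀ h ∈ K, δ ≤ (h.pairing (R.simpleCoroot i)).im :=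
    hK.exists_forall_le' (Complex.continuous_im.comp
      (Complexification.differentiable_pairing _).continuous).continuousOn
      fun h hh => (R.mem_tube_iff h).1 (hKt hh) i
  choose δ hδ hδK using hex
  rcases isEmpty_or_nonempty ι with hι | hι
  · exact ⟨1, one_pos, fun _ _ i => isEmptyElim i⟩
  · obtain ⟨i₀, hi₀⟩ := Finite.exists_min δ
    exact ⟨δ i₀, hδ i₀, fun h hh i => (hi₀ i).trans (hδK i h hh)⟩

/-- On a compact subset of the tube the exponentials of the coroots are bounded, uniformly, by a
geometric expression in the height. -/
theorem exists_forall_norm_expCoroot_le [Finite ι] [Module.Finite ℝ V]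
    {K : Set (Complexification V)} (hK : IsCompact K) (hKt : K ⊆ R.tube) :
    ∃ q : ℝ, 0 < q ∧ q < 1 ∧
      ∀ h ∈ K, ∀ b, ‖R.expCoroot h b‖ ≤ q ^ (R.corootCoeff b).degree := by
  obtain ⟨δ, hδ, hδK⟩ := R.exists_pos_forall_le_im_pairing hK hKt
  refine ⟨Real.exp (-(2 * Real.pi * δ)), Real.exp_pos _, ?_,
    fun h hh b => R.norm_expCoroot_le (hδK h hh) b⟩
  rw [Real.exp_lt_one_iff, neg_lt_zero]
  have := Real.pi_pos
  positivity

theorem one_le_degree_corootCoeff (b : R.posRealRoots) : 1 ≤ (R.corootCoeff b).degree := by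
  rw [Nat.one_le_iff_ne_zero, Ne, Finsupp.degree_eq_zero_iff]
  exact R.corootCoeff_ne_zero b

theorem norm_expCoroot_lt_one [Finite ι] [Module.Finite ℝ V] {h : Complexification V}
    (hh : h ∈ R.tube) (b : R.posRealRoots) : ‖R.expCoroot h b‖ < 1 := by
  obtain ⟨q, hq, hq1, hqb⟩ := R.exists_forall_norm_expCoroot_le (isCompact_singleton (x := h))
    (Set.singleton_subset_iff.2 hh)
  refine (hqb h rfl b).trans_lt (pow_lt_one₀ hq.le hq1 ?_)
  exact (Nat.one_le_iff_ne_zero.1 (R.one_le_degree_corootCoeff b))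

theorem summable_pow_degree_corootCoeff [Finite ι] {q : ℝ} (hq : 0 ≤ q) (hq' : q < 1) :
    Summable fun b => q ^ (R.corootCoeff b).degree :=
  (summable_pow_degree hq hq').comp_injective R.corootCoeff_injective

/-! ### The Poincaré series -/

theorem finite_setOf_length_eq [Finite ι] (n : ℕ) : Finite {w : R.weylGroup // R.length w = n} := by
  have : Finite {L : List ι // L.length = n} := (List.finite_length_eq ι n).to_subtype
  refine Finite.of_surjective
    (α := {L : {L : List ι // L.length = n} //
      R.length ⟨R.wordProd L.1, R.wordProd_mem L.1⟩ = n})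
    (fun L => ⟨⟨R.wordProd L.1.1, R.wordProd_mem L.1.1⟩, L.2⟩) ?_
  rintro ⟨⟨g, hg⟩, hw⟩
  obtain ⟨L, hL, rfl⟩ := R.exists_reduced_word hg
  exact ⟨⟨⟨L, hL.trans hw⟩, hw⟩, rfl⟩

theorem summable_pow_length [Finite ι] {ρ : NNReal} (hρ : ρ < R.poincareRadius) :
    Summable fun w : R.weylGroup => (ρ : ℝ) ^ R.length w := by
  have := R.finite_setOf_length_eq
  have hs := FormalMultilinearSeries.summable_norm_mul_pow _ hρ
  simp only [FormalMultilinearSeries.ofScalars_norm, RCLike.norm_natCast] at hs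
  refine (Equiv.summable_iff (Equiv.sigmaFiberEquiv R.length)).1 ?_
  refine (summable_sigma_of_nonneg fun x => by simp only [Function.comp_apply]; positivity).2
    ⟨fun n => Summable.of_finite, hs.congr fun n => ?_⟩
  rw [tsum_congr (g := fun _ => (ρ : ℝ) ^ n) fun w => by
    simp only [Function.comp_apply, Equiv.sigmaFiberEquiv_apply, w.2], tsum_const, nsmul_eq_mul]

/-- At a point `ρ = 1` inside the disc of convergence, the Poincaré series would count the elements
of the Weyl group. -/
theorem poincareRadius_le_one [Finite ι] [Infinite R.weylGroup] : R.poincareRadius ≤ 1 := by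
  by_contra! h
  have := R.summable_pow_length (ρ := 1) (by simpa using h)
  simp [summable_const_iff] at this

/-- The two clauses in the definition of the disc amount to `|t| < min r 1`: the radius of
convergence `r` is at most `1` when the Weyl group is infinite, and the disc is cut down to the unit
disc when it is finite. -/
theorem disc_eq_ball [Finite ι] : R.disc = Metric.ball 0 (min R.poincareRadius 1).toReal := by
  ext t
  have hfin : min R.poincareRadius 1 ≠ ⊤ :=
    ne_top_of_le_ne_top ENNReal.one_ne_top (min_le_right _ _)
  rw [mem_ball_zero_iff, ← toReal_enorm, ENNReal.toReal_lt_toReal enorm_ne_top hfin, lt_min_iff]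
  change (_ ∧ _) ↔ _
  have h1 : ‖t‖ₑ < 1 ↔ ‖t‖ < 1 := by
    rw [← toReal_enorm, ← ENNReal.toReal_one,
      ENNReal.toReal_lt_toReal enorm_ne_top ENNReal.one_ne_top]
  rw [h1]
  refine and_congr_right fun ht => ⟨fun h => ?_, fun h _ => h⟩
  rcases finite_or_infinite R.weylGroup with hW | hW
  · exact h hW
  · exact h1.1 (ht.trans_le R.poincareRadius_le_one)

theorem isOpen_disc [Finite ι] : IsOpen R.disc := R.disc_eq_ball ▸ Metric.isOpen_ball

theorem norm_lt_one_of_mem_disc [Finite ι] {t : ℂ} (ht : t ∈ R.disc) : ‖t‖ < 1 := by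
  rw [disc_eq_ball, mem_ball_zero_iff] at ht
  exact ht.trans_le (ENNReal.toReal_le_of_le_ofReal zero_le_one (by simp))

/-- A compact subset of the disc lies in a smaller disc. -/
theorem exists_forall_norm_le_of_subset_disc [Finite ι] {K : Set ℂ} (hK : IsCompact K)
    (hKd : K ⊆ R.disc) (hne : K.Nonempty) :
    ∃ ρ : NNReal, 0 < ρ ∧ ρ ≤ 1 ∧ ρ < R.poincareRadius ∧ ∀ t ∈ K, ‖t‖ ≤ ρ := by
  obtain ⟨t₀, ht₀, hmax⟩ := hK.exists_isMaxOn hne continuous_norm.continuousOn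
  have h₀ := hKd ht₀
  obtain ⟨ρ, h1, h2⟩ := ENNReal.lt_iff_exists_nnreal_btwn.1
    (lt_min (a := ‖t₀‖ₑ) (c := 1) h₀.1 (by
      rw [← ofReal_norm]
      exact ENNReal.ofReal_lt_one.2 (R.norm_lt_one_of_mem_disc h₀)))
  refine ⟨ρ, ?_, ?_, h2.trans_le (min_le_left _ _), fun t ht => ?_⟩
  · exact_mod_cast (zero_le (a := ‖t₀‖ₑ)).trans_lt h1
  · exact_mod_cast (h2.trans_le (min_le_right _ _)).le
  · refine (isMaxOn_iff.1 hmax t ht).trans ?_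
    have : ‖t₀‖₊ < ρ := by exact_mod_cast h1
    exact_mod_cast this.le

/-! ### The sum over the Weyl group and the product over the positive real roots -/

theorem sumTerm_eq_prod (w : R.weylGroup) (p : ℂ × Complexification V) :
    R.sumTerm w p = ∏ b ∈ (R.finite_inversionSet w).toFinset,
      (p.1 - R.expCoroot p.2 b) / (1 - p.1 * R.expCoroot p.2 b) :=
  finprod_mem_eq_finite_toFinset_prod _ _

theorem differentiable_expCoroot_snd [Module.Finite ℝ V] (b : R.posRealRoots) :
    Differentiable ℂ fun p : ℂ × Complexification V => R.expCoroot p.2 b :=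
  (R.differentiable_expCoroot b).comp differentiable_snd

section Holomorphy

variable [Finite ι] [Module.Finite ℝ V]

theorem one_sub_mul_expCoroot_ne_zero {t : ℂ} (ht : t ∈ R.disc) {h : Complexification V}
    (hh : h ∈ R.tube) (b : R.posRealRoots) : 1 - t * R.expCoroot h b ≠ 0 := by
  refine one_sub_ne_zero_of_norm_lt_one ?_
  rw [norm_mul]
  exact mul_lt_one_of_nonneg_of_lt_one_left (norm_nonneg _) (R.norm_lt_one_of_mem_disc ht)
    (R.norm_expCoroot_lt_one hh b).le

theorem one_sub_expCoroot_ne_zero {h : Complexification V} (hh : h ∈ R.tube)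
    (b : R.posRealRoots) : 1 - R.expCoroot h b ≠ 0 :=
  one_sub_ne_zero_of_norm_lt_one (R.norm_expCoroot_lt_one hh b)

theorem differentiableOn_sumTerm (w : R.weylGroup) :
    DifferentiableOn ℂ (R.sumTerm w) (R.disc ×ˢ R.tube) := by
  rw [funext (R.sumTerm_eq_prod w)]
  simp only [div_eq_mul_inv]
  refine differentiableOn_finsetProd _ fun b => ?_
  have hb := (R.differentiable_expCoroot_snd b).differentiableOn (s := R.disc ×ˢ R.tube)
  exact (differentiableOn_fst.fun_sub hb).fun_mul
    (((differentiableOn_const 1).fun_sub (differentiableOn_fst.fun_mul hb)).fun_inv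
      fun p hp => R.one_sub_mul_expCoroot_ne_zero hp.1 hp.2 b)

theorem differentiableOn_prodFactor (b : R.posRealRoots) :
    DifferentiableOn ℂ (R.prodFactor b) (R.disc ×ˢ R.tube) := by
  have hb := (R.differentiable_expCoroot_snd b).differentiableOn (s := R.disc ×ˢ R.tube)
  unfold prodFactor
  simp only [div_eq_mul_inv]
  exact ((differentiableOn_const 1).fun_sub (differentiableOn_fst.fun_mul hb)).fun_mul
    (((differentiableOn_const 1).fun_sub hb).fun_inv
      fun p hp => R.one_sub_expCoroot_ne_zero hp.2 b)

/-- Summable majorants, on a compact set, of the terms of the sum and of the factors minus `1` of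
the product. Since `Φ(w)` has at least `ℓ(w)` elements, the term of `w` is at most a constant times
`ρ ^ ℓ(w)`, where `ρ` is smaller than the radius of convergence of the Poincaré series. -/
theorem exists_summable_bounds {K : Set (ℂ × Complexification V)} (hK : IsCompact K)
    (hKD : K ⊆ R.disc ×ˢ R.tube) :
    ∃ (u : R.weylGroup → ℝ) (v : R.posRealRoots → ℝ), Summable u ∧ Summable v ∧
      (∀ w, ∀ p ∈ K, ‖R.sumTerm w p‖ ≤ u w) ∧ ∀ b, ∀ p ∈ K, ‖R.prodFactor b p - 1‖ ≤ v b := by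
  rcases K.eq_empty_or_nonempty with rfl | hne
  · exact ⟨0, 0, summable_zero, summable_zero, by simp, by simp⟩
  obtain ⟨ρ, hρ, hρ1, hρr, hρK⟩ := R.exists_forall_norm_le_of_subset_disc
    (hK.image continuous_fst) (Set.image_subset_iff.2 fun p hp => (hKD hp).1) (hne.image _)
  obtain ⟨q, hq, hq1, hqK⟩ := R.exists_forall_norm_expCoroot_le
    (hK.image continuous_snd) (Set.image_subset_iff.2 fun p hp => (hKD hp).2)
  have hu := R.summable_pow_degree_corootCoeff hq.le hq1
  have huq (b : R.posRealRoots) : q ^ (R.corootCoeff b).degree ≤ q :=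
    pow_le_of_le_one hq.le hq1.le (Nat.one_le_iff_ne_zero.1 (R.one_le_degree_corootCoeff b))
  have hρ0 : (0 : ℝ) < ρ := by exact_mod_cast hρ
  have hρ1' : (ρ : ℝ) ≤ 1 := by exact_mod_cast hρ1
  set C : ℝ := (1 + (ρ : ℝ)⁻¹) / (1 - q) with hC
  have hC0 : 0 ≤ C := div_nonneg (by positivity) (by linarith)
  refine ⟨fun w => ρ ^ R.length w * Real.exp (∑' b, C * q ^ (R.corootCoeff b).degree),
    fun b => 2 / (1 - q) * q ^ (R.corootCoeff b).degree,
    (R.summable_pow_length hρr).mul_right _, hu.mul_left _, fun w p hp => ?_, fun b p hp => ?_⟩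
  · rw [sumTerm_eq_prod, norm_prod]
    set s := (R.finite_inversionSet w).toFinset with hs
    calc ∏ b ∈ s, ‖(p.1 - R.expCoroot p.2 b) / (1 - p.1 * R.expCoroot p.2 b)‖
        ≤ ∏ b ∈ s, (ρ * Real.exp (C * q ^ (R.corootCoeff b).degree)) := by
          refine Finset.prod_le_prod (fun b _ => norm_nonneg _) fun b _ => ?_
          refine (norm_sub_div_one_sub_mul_le hρ0 hρ1' (hρK _ ⟨p, hp, rfl⟩)
            (hqK _ ⟨p, hp, rfl⟩ b) (huq b) hq1).trans ?_
          refine mul_le_mul_of_nonneg_left ?_ hρ0.le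
          rw [add_comm]
          exact Real.add_one_le_exp _
      _ = (ρ : ℝ) ^ s.card * Real.exp (∑ b ∈ s, C * q ^ (R.corootCoeff b).degree) := by
          rw [Finset.prod_mul_distrib, Finset.prod_const, Real.exp_sum]
      _ ≤ _ := by
          refine mul_le_mul
            (pow_le_pow_of_le_one hρ0.le hρ1' (R.length_le_card_inversionSet w))
            (Real.exp_le_exp.2 ((hu.mul_left C).sum_le_tsum _ fun b _ => by positivity))
            (Real.exp_nonneg _) (by positivity)
  · exact norm_one_sub_mul_div_one_sub_sub_one_le ((hρK _ ⟨p, hp, rfl⟩).trans hρ1')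
      (hqK _ ⟨p, hp, rfl⟩ b) (huq b) hq1

theorem hasSumUniformlyOn_sumTerm {K : Set (ℂ × Complexification V)} (hK : IsCompact K)
    (hKD : K ⊆ R.disc ×ˢ R.tube) :
    HasSumUniformlyOn R.sumTerm (fun p => ∑' w, R.sumTerm w p) K := by
  obtain ⟨u, v, hu, -, hu', -⟩ := R.exists_summable_bounds hK hKD
  exact .of_norm_le_summable hu hu'

theorem hasProdUniformlyOn_prodFactor {K : Set (ℂ × Complexification V)} (hK : IsCompact K)
    (hKD : K ⊆ R.disc ×ˢ R.tube) :
    HasProdUniformlyOn R.prodFactor (fun p => ∏' b, R.prodFactor b p) K := by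
  obtain ⟨u, v, -, hv, -, hv'⟩ := R.exists_summable_bounds hK hKD
  have := Summable.hasProdUniformlyOn_one_add (f := fun b p => R.prodFactor b p - 1) hK hv
    (.of_forall hv') fun b =>
      ((R.differentiableOn_prodFactor b).continuousOn.mono hKD).sub continuousOn_const
  simpa only [add_sub_cancel] using this

theorem tendstoUniformlyOn_correction {K : Set (ℂ × Complexification V)} (hK : IsCompact K)
    (hKD : K ⊆ R.disc ×ˢ R.tube) :
    TendstoUniformlyOn
      (fun (s : Finset R.weylGroup × Finset R.posRealRoots) p =>
        (∑ w ∈ s.1, R.sumTerm w p) * ∏ b ∈ s.2, R.prodFactor b p)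
      R.correction Filter.atTop K := by
  have hS := (R.hasSumUniformlyOn_sumTerm hK hKD).tendstoUniformlyOn
  have hP := (R.hasProdUniformlyOn_prodFactor hK hKD).tendstoUniformlyOn
  have hSc := hS.continuousOn (.of_forall fun s =>
    ((DifferentiableOn.fun_sum fun w _ => R.differentiableOn_sumTerm w).continuousOn.mono hKD))
  have hPc := hP.continuousOn (.of_forall fun s =>
    ((differentiableOn_finsetProd s fun b =>
      R.differentiableOn_prodFactor b).continuousOn.mono hKD))
  rw [← Filter.prod_atTop_atTop_eq]
  rw [← tendstoLocallyUniformlyOn_iff_tendstoUniformlyOn_of_compact hK]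
  have hS' : TendstoUniformlyOn (fun (s : Finset R.weylGroup × Finset R.posRealRoots) p =>
      ∑ w ∈ s.1, R.sumTerm w p) _ (Filter.atTop ×ˢ Filter.atTop) K :=
    fun U hU => Filter.tendsto_fst.eventually (hS U hU)
  have hP' : TendstoUniformlyOn (fun (s : Finset R.weylGroup × Finset R.posRealRoots) p =>
      ∏ b ∈ s.2, R.prodFactor b p) _ (Filter.atTop ×ˢ Filter.atTop) K :=
    fun U hU => Filter.tendsto_snd.eventually (hP U hU)
  exact hS'.tendstoLocallyUniformlyOn.mul₀ hP'.tendstoLocallyUniformlyOn hSc hPc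

theorem differentiableOn_correction : DifferentiableOn ℂ R.correction (R.disc ×ˢ R.tube) := by
  classical
  have : ProperSpace (Complexification V) := FiniteDimensional.proper ℂ _
  refine differentiableOn_of_forall_isCompact_tendstoUniformlyOn
    (R.isOpen_disc.prod R.isOpen_tube) (fun s => ?_)
    fun K hKD hK => R.tendstoUniformlyOn_correction hK hKD
  exact (DifferentiableOn.fun_sum fun w _ => R.differentiableOn_sumTerm w).fun_mul
    (differentiableOn_finsetProd s.2 fun b => R.differentiableOn_prodFactor b)

end Holomorphy

end KacMoodyRootSystem

theorem proposition3p1p1 {ι V : Type*} [Finite ι] [AddCommGroup V] [Module ℝ V]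
    [Module.Finite ℝ V] (R : KacMoodyRootSystem ι V) :
    -- the expression is well formed: `Φ(w)` is finite and no denominator vanishes
    (∀ w : R.weylGroup, (R.inversionSet w).Finite) ∧
    (∀ t ∈ R.disc, ∀ h ∈ R.tube, ∀ b : R.posRealRoots,
      1 - t * R.expCoroot h b ≠ 0 ∧ 1 - R.expCoroot h b ≠ 0) ∧
    -- the sum and the product converge absolutely and uniformly on compact sets
    (∀ K ⊆ R.disc ×ˢ R.tube, IsCompact K →
      SummableUniformlyOn (fun w p => ‖R.sumTerm w p‖) K ∧
      SummableUniformlyOn R.sumTerm K ∧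
      SummableUniformlyOn (fun b p => ‖R.prodFactor b p - 1‖) K ∧
      MultipliableUniformlyOn R.prodFactor K ∧
      -- and so do the products of their partial sums and partial products
      TendstoUniformlyOn
        (fun (s : Finset R.weylGroup × Finset R.posRealRoots) p =>
          (∑ w ∈ s.1, R.sumTerm w p) * ∏ b ∈ s.2, R.prodFactor b p)
        R.correction Filter.atTop K) ∧
    -- and their product is holomorphic on the domain
    IsOpen (R.disc ×ˢ R.tube) ∧
    DifferentiableOn ℂ R.correction (R.disc ×ˢ R.tube) := by
  refine ⟨R.finite_inversionSet, fun t ht h hh b =>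
    ⟨R.one_sub_mul_expCoroot_ne_zero ht hh b, R.one_sub_expCoroot_ne_zero hh b⟩,
    fun K hKD hK => ⟨?_, (R.hasSumUniformlyOn_sumTerm hK hKD).summableUniformlyOn, ?_,
      (R.hasProdUniformlyOn_prodFactor hK hKD).multipliableUniformlyOn,
      R.tendstoUniformlyOn_correction hK hKD⟩,
    R.isOpen_disc.prod R.isOpen_tube, R.differentiableOn_correction⟩
  all_goals obtain ⟨u, v, hu, hv, hu', hv'⟩ := R.exists_summable_bounds hK hKD
  · exact (HasSumUniformlyOn.of_norm_le_summable hu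
      (by simpa only [norm_norm] using hu')).summableUniformlyOn
  · exact (HasSumUniformlyOn.of_norm_le_summable hv
      (by simpa only [norm_norm] using hv')).summableUniformlyOn
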